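/- **Setting.** Formulae over a set $Var$ of propositional variables are $A ::= p \mid \top \mid \bot \mid \top^* \mid A\wedge A \mid A\to A \mid A * A \mid A \mathbin{-\!*} A$ ($p\in Var$). A *Kripke relational frame* is $(H,R,\epsilon)$ with $\epsilon\in H$ and $R\subseteq H^3$; a *Kripke relational model* adds $v:Var\to\mathcal P(H)$. Forcing: $h\Vdash p$ iff $h\in v(p)$; $\top,\bot,\wedge,\to$ are classical at each world; $h\Vdash\top^*$ iff $h=\epsilon$; $h\Vdash A*B$ iff there are $h_1,h_2$ with $R(h_1,h_2,h)$, $h_1\Vdash A$ and $h_2\Vdash B$; $h\Vdash A\mathbin{-\!*}B$ iff for all $h_1,h_2$ with $R(h_1,h,h_2)$ and $h_1\Vdash A$ we have $h_2\Vdash B$. A *frame axiom* is a closed first-order formula $$\forall x_1,\dots,x_m.\,(s_1=t_1\,\&\cdots\&\,s_p=t_p\,\&\,S_1\,\&\cdots\&\,S_k\Rightarrow\exists y_1,\dots,y_n.\,(T_1\,\&\cdots\&\,T_l))$$ ($m,n,p,k,l\ge 0$) where each $s_i,t_i$ is $\epsilon$ or some $x_j$; each $S_i$ is an inequality between such terms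 or a ternary atom $(u,v\triangleright w)$ with $u,v,w\in\{x_1,\dots,x_m\}$; each $x_j$ occurs at most once in $S_1,\dots,S_k$; and each $T_i$ is an equality, an inequality or a ternary atom over $\epsilon,x_1,\dots,x_m,y_1,\dots,y_n$. Its truth in a frame is first-order truth, $\triangleright$ being interpreted by $R$. *Labels* are the constant $\epsilon$ and countably many label variables. A *sequent* $\mathcal G;\Gamma\vdash\Delta$ consists of a finite set $\mathcal G$ of relational atoms $(x,y\triangleright z)$, $x=y$, $x\ne y$ between labels and finite sets $\Gamma,\Delta$ of labelled formulae $w:A$; the semicolon denotes union. $E(\mathcal G)\vdash x=y$ means that $(x,y)$ lies in the equivalence relation on labels generated by the equality atoms of $\mathcal G$. For a set $\mathcal{F}r$ of frame axioms, the cut-free rules of the corresponding instance of the general labelled calculus $LS_G$ are as follows (premises $\Longrightarrow$ conclusion): - $id$: $\mathcal G;\Gamma;w:p\vdash w':p;\Delta$ if $E(\mathcal G)\vdash w=w'$, for $p\in Var$. - $\bot L$: $\mathcal G;\Gamma;w:\bot\vdash\Delta$. $\top R$: $\mathcal G;\Gamma\vdash w:\top;\Delta$. - $\top^*L$: $\mathcal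 G;w=\epsilon;\Gamma\vdash\Delta\Longrightarrow\mathcal G;\Gamma;w:\top^*\vdash\Delta$. $\top^*R$: $\mathcal G;\Gamma\vdash w:\top^*;\Delta$ if $E(\mathcal G)\vdash w=\epsilon$. - $\wedge L$: $\mathcal G;\Gamma;w:A;w:B\vdash\Delta\Longrightarrow\mathcal G;\Gamma;w:A\wedge B\vdash\Delta$. $\wedge R$: $\mathcal G;\Gamma\vdash w:A;\Delta$ and $\mathcal G;\Gamma\vdash w:B;\Delta\Longrightarrow\mathcal G;\Gamma\vdash w:A\wedge B;\Delta$. - $\to L$: $\mathcal G;\Gamma\vdash w:A;\Delta$ and $\mathcal G;\Gamma;w:B\vdash\Delta\Longrightarrow\mathcal G;\Gamma;w:A\to B\vdash\Delta$. $\to R$: $\mathcal G;\Gamma;w:A\vdash w:B;\Delta\Longrightarrow\mathcal G;\Gamma\vdash w:A\to B;\Delta$. - $*L$: $\mathcal G;(x,y\triangleright z);\Gamma;x:A;y:B\vdash\Delta\Longrightarrow\mathcal G;\Gamma;z:A*B\vdash\Delta$, with $x,y$ distinct label variables not occurring in the conclusion. - $*R$: if $E(\mathcal G)\vdash z=z'$,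 then $\mathcal G;(x,y\triangleright z');\Gamma\vdash x:A;z:A*B;\Delta$ and $\mathcal G;(x,y\triangleright z');\Gamma\vdash y:B;z:A*B;\Delta\Longrightarrow\mathcal G;(x,y\triangleright z');\Gamma\vdash z:A*B;\Delta$. - $-\!*L$: if $E(\mathcal G)\vdash z=z'$, then $\mathcal G;(x,z'\triangleright y);\Gamma;z:A\mathbin{-\!*}B\vdash x:A;\Delta$ and $\mathcal G;(x,z'\triangleright y);\Gamma;z:A\mathbin{-\!*}B;y:B\vdash\Delta\Longrightarrow\mathcal G;(x,z'\triangleright y);\Gamma;z:A\mathbin{-\!*}B\vdash\Delta$. - $-\!*R$: $\mathcal G;(x,z\triangleright y);\Gamma;x:A\vdash y:B;\Delta\Longrightarrow\mathcal G;\Gamma\vdash z:A\mathbin{-\!*}B;\Delta$, with $x,y$ distinct label variables not occurring in the conclusion. - $NEq$: $\mathcal G;w\ne w';\Gamma\vdash\Delta$ if $E(\mathcal G)\vdash w=w'$. - $EM$: $\mathcal G;x=y;\Gamma\vdash\Delta$ and $\mathcal G;x\ne y;\Gamma\vdash\Delta\Longrightarrow\mathcal G;\Gamma\vdash\Delta$.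 - For each frame axiom in $\mathcal{F}r$, written as above, its structural rule. Let $\theta$ map $x_1,\dots,x_m$ to labels, and let $\sigma$ map $y_1,\dots,y_n$ to pairwise distinct label variables that do not occur in the conclusion and are not among the labels $x_i\theta$. If $E(\mathcal G)\vdash s_i\theta=t_i\theta$ for all $i\le p$, then $\mathcal G;S_1\theta;\dots;S_k\theta;T_1\theta\sigma;\dots;T_l\theta\sigma;\Gamma\vdash\Delta\Longrightarrow\mathcal G;S_1\theta;\dots;S_k\theta;\Gamma\vdash\Delta$. **Theorem.** Let $\mathcal{F}r$ be a finite set of frame axioms, $F$ a formula and $w\neq\epsilon$ a label. If the sequent $\vdash w:F$ has no cut-free derivation in the instance of $LS_G$ given by $\mathcal{F}r$, then there are a Kripke relational model $(H,R,\epsilon,v)$ whose frame satisfies every axiom in $\mathcal{F}r$ and a world $h\in H$ with $h\not\Vdash F$. -/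

import Mathlib

namespace LSG

/-- Formulae over a set `Var` of propositional variables. Negation and disjunction are the usual
classical abbreviations. -/
inductive Formula (Var : Type*) where
  | var (p : Var)
  | top
  | bot
  | emp
  | and (A B : Formula Var)
  | imp (A B : Formula Var)
  | star (A B : Formula Var)
  | wand (A B : Formula Var)
  deriving DecidableEq

/-! ### Terms, labels, relational atoms -/

/-- The constant `ε` or a variable from `V`. -/
inductive Term (V : Type*) where
  | eps
  | var (v : V)
  deriving DecidableEq

/-- Replace every variable by a term; the constant `ε` is left alone. -/
def Term.subst {V W : Type*} (θ : V → Term W) : Term V → Term W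
  | .eps => .eps
  | .var v => θ v

/-- The list of variable occurrences (of length 0 or 1). -/
def Term.vars {V : Type*} : Term V → List V
  | .eps => []
  | .var v => [v]

/-- Relational atoms: `rel x y z` is the ternary atom `(x, y ▷ z)`, `eq x y` is `x = y` and
`neq x y` is `x ≠ y`. -/
inductive Atom (V : Type*) where
  | rel (x y z : Term V)
  | eq (x y : Term V)
  | neq (x y : Term V)
  deriving DecidableEq

def Atom.subst {V W : Type*} (θ : V → Term W) : Atom V → Atom W
  | .rel x y z => .rel (x.subst θ) (y.subst θ) (z.subst θ)
  | .eq x y => .eq (x.subst θ) (y.subst θ)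
  | .neq x y => .neq (x.subst θ) (y.subst θ)

/-- The list of variable occurrences of an atom, with repetitions. -/
def Atom.vars {V : Type*} : Atom V → List V
  | .rel x y z => x.vars ++ y.vars ++ z.vars
  | .eq x y => x.vars ++ y.vars
  | .neq x y => x.vars ++ y.vars

/-- Labels: the constant `ε` and countably many label variables. -/
abbrev Label := Term ℕ

/-! ### Frame axioms -/

/-- The atoms allowed in the antecedent of a frame axiom besides its equations: inequalities, and
ternary atoms in which `ε` does not occur. -/
def Atom.IsAntecedent {V : Type*} : Atom V → Prop
  | .rel x y z => x ≠ .eps ∧ y ≠ .eps ∧ z ≠ .eps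
  | .eq _ _ => False
  | .neq _ _ => True

/-- A frame axiom
`∀ x₁ … x_m, (s₁ = t₁ & … & s_p = t_p & S₁ & … & S_k ⇒ ∃ y₁ … y_n, (T₁ & … & T_l))`.
The `x`s are indexed by `Fin m` and the `y`s by `Fin n`. -/
structure FrameAxiom where
  m : ℕ
  n : ℕ
  /-- the pairs `(s_i, t_i)` -/
  eqs : List (Term (Fin m) × Term (Fin m))
  /-- the atoms `S_i` -/
  ante : List (Atom (Fin m))
  /-- the atoms `T_i` -/
  concl : List (Atom (Fin m ⊕ Fin n))
  ante_form : ∀ S ∈ ante, S.IsAntecedent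
  /-- each variable occurs at most once in `S₁, …, S_k` -/
  ante_linear : (ante.flatMap Atom.vars).Nodup

/-! ### Kripke relational semantics -/

/-- A Kripke relational frame `(H, R, ε)`. -/
structure KripkeFrame where
  World : Type*
  R : World → World → World → Prop
  unit : World

def Term.eval {V : Type*} (K : KripkeFrame) (μ : V → K.World) : Term V → K.World
  | .eps => K.unit
  | .var v => μ v

def Atom.Holds {V : Type*} (K : KripkeFrame) (μ : V → K.World) : Atom V → Prop
  | .rel x y z => K.R (x.eval K μ) (y.eval K μ) (z.eval K μ)
  | .eq x y => x.eval K μ = y.eval K μ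
  | .neq x y => x.eval K μ ≠ y.eval K μ

/-- First-order truth of a frame axiom in a Kripke relational frame. -/
def KripkeFrame.Satisfies (K : KripkeFrame) (ax : FrameAxiom) : Prop :=
  ∀ μ : Fin ax.m → K.World,
    (∀ e ∈ ax.eqs, e.1.eval K μ = e.2.eval K μ) →
    (∀ S ∈ ax.ante, S.Holds K μ) →
    ∃ ν : Fin ax.n → K.World, ∀ T ∈ ax.concl, T.Holds K (Sum.elim μ ν)

/-- A Kripke relational model: a frame with a valuation. -/
structure KripkeModel (Var : Type*) extends KripkeFrame where
  val : Var → Set World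

/-- The forcing relation between worlds and formulae. -/
def KripkeModel.Forces {Var : Type*} (M : KripkeModel Var) : M.World → Formula Var → Prop
  | h, .var p => h ∈ M.val p
  | _, .top => True
  | _, .bot => False
  | h, .emp => h = M.unit
  | h, .and A B => M.Forces h A ∧ M.Forces h B
  | h, .imp A B => M.Forces h A → M.Forces h B
  | h, .star A B => ∃ h₁ h₂, M.R h₁ h₂ h ∧ M.Forces h₁ A ∧ M.Forces h₂ B
  | h, .wand A B => ∀ h₁ h₂, M.R h₁ h h₂ → M.Forces h₁ A → M.Forces h₂ B

/-! ### The labelled sequent calculus -/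

/-- A labelled sequent `G; Γ ⊢ Δ`, made of a finite set `G` of relational atoms and finite sets
`Γ`, `Δ` of labelled formulae `w : A`. -/
structure Sequent (Var : Type*) where
  G : Finset (Atom ℕ)
  Γ : Finset (Label × Formula Var)
  Δ : Finset (Label × Formula Var)

/-- The label variable `a` does not occur in the sequent. -/
def Sequent.Fresh {Var : Type*} (s : Sequent Var) (a : ℕ) : Prop :=
  (∀ r ∈ s.G, a ∉ r.vars) ∧ (∀ f ∈ s.Γ, f.1 ≠ .var a) ∧ (∀ f ∈ s.Δ, f.1 ≠ .var a)

/-- The judgment `E(G) ⊢ a = b`: the equation follows from the equality atoms of `G` by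
reflexivity, symmetry and transitivity. -/
def EqJudgment (G : Finset (Atom ℕ)) : Label → Label → Prop :=
  Relation.EqvGen fun a b => Atom.eq a b ∈ G

/-- Cut-free derivability in the instance of the general labelled calculus given by the set `Fr`
of frame axioms: the rules of the base calculus without cut, and for each frame axiom the
structural rule synthesised from it. Since sequents are made of sets, the `Γ` of `insert f Γ` may
contain `f` itself. -/
inductive CutFreeDerivable {Var : Type*} [DecidableEq Var] (Fr : Set FrameAxiom) :
    Sequent Var → Prop
  | id {G Γ Δ} (w w' : Label) (p : Var) :
      EqJudgment G w w' →
      CutFreeDerivable Fr ⟨G, insert (w, .var p) Γ, insert (w', .var p) Δ⟩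
  | botL {G Γ Δ} (w : Label) :
      CutFreeDerivable Fr ⟨G, insert (w, .bot) Γ, Δ⟩
  | topR {G Γ Δ} (w : Label) :
      CutFreeDerivable Fr ⟨G, Γ, insert (w, .top) Δ⟩
  | empL {G Γ Δ} (w : Label) :
      CutFreeDerivable Fr ⟨insert (.eq w .eps) G, Γ, Δ⟩ →
      CutFreeDerivable Fr ⟨G, insert (w, .emp) Γ, Δ⟩
  | empR {G Γ Δ} (w : Label) :
      EqJudgment G w .eps →
      CutFreeDerivable Fr ⟨G, Γ, insert (w, .emp) Δ⟩
  | andL {G Γ Δ} (w : Label) (A B : Formula Var) :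
      CutFreeDerivable Fr ⟨G, insert (w, A) (insert (w, B) Γ), Δ⟩ →
      CutFreeDerivable Fr ⟨G, insert (w, .and A B) Γ, Δ⟩
  | andR {G Γ Δ} (w : Label) (A B : Formula Var) :
      CutFreeDerivable Fr ⟨G, Γ, insert (w, A) Δ⟩ →
      CutFreeDerivable Fr ⟨G, Γ, insert (w, B) Δ⟩ →
      CutFreeDerivable Fr ⟨G, Γ, insert (w, .and A B) Δ⟩
  | impL {G Γ Δ} (w : Label) (A B : Formula Var) :
      CutFreeDerivable Fr ⟨G, Γ, insert (w, A) Δ⟩ →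
      CutFreeDerivable Fr ⟨G, insert (w, B) Γ, Δ⟩ →
      CutFreeDerivable Fr ⟨G, insert (w, .imp A B) Γ, Δ⟩
  | impR {G Γ Δ} (w : Label) (A B : Formula Var) :
      CutFreeDerivable Fr ⟨G, insert (w, A) Γ, insert (w, B) Δ⟩ →
      CutFreeDerivable Fr ⟨G, Γ, insert (w, .imp A B) Δ⟩
  /- `x` and `y` are distinct label variables that do not occur in the conclusion. -/
  | starL {G Γ Δ} (z : Label) (A B : Formula Var) (x y : ℕ) :
      x ≠ y →
      Sequent.Fresh ⟨G, insert (z, .star A B) Γ, Δ⟩ x →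
      Sequent.Fresh ⟨G, insert (z, .star A B) Γ, Δ⟩ y →
      CutFreeDerivable Fr
        ⟨insert (.rel (.var x) (.var y) z) G, insert (.var x, A) (insert (.var y, B) Γ), Δ⟩ →
      CutFreeDerivable Fr ⟨G, insert (z, .star A B) Γ, Δ⟩
  | starR {G Γ Δ} (x y z z' : Label) (A B : Formula Var) :
      EqJudgment G z z' →
      CutFreeDerivable Fr
        ⟨insert (.rel x y z') G, Γ, insert (x, A) (insert (z, .star A B) Δ)⟩ →
      CutFreeDerivable Fr
        ⟨insert (.rel x y z') G, Γ, insert (y, B) (insert (z, .star A B) Δ)⟩ →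
      CutFreeDerivable Fr ⟨insert (.rel x y z') G, Γ, insert (z, .star A B) Δ⟩
  | wandL {G Γ Δ} (x y z z' : Label) (A B : Formula Var) :
      EqJudgment G z z' →
      CutFreeDerivable Fr
        ⟨insert (.rel x z' y) G, insert (z, .wand A B) Γ, insert (x, A) Δ⟩ →
      CutFreeDerivable Fr
        ⟨insert (.rel x z' y) G, insert (y, B) (insert (z, .wand A B) Γ), Δ⟩ →
      CutFreeDerivable Fr ⟨insert (.rel x z' y) G, insert (z, .wand A B) Γ, Δ⟩
  /- `x` and `y` are distinct label variables that do not occur in the conclusion. -/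
  | wandR {G Γ Δ} (z : Label) (A B : Formula Var) (x y : ℕ) :
      x ≠ y →
      Sequent.Fresh ⟨G, Γ, insert (z, .wand A B) Δ⟩ x →
      Sequent.Fresh ⟨G, Γ, insert (z, .wand A B) Δ⟩ y →
      CutFreeDerivable Fr
        ⟨insert (.rel (.var x) z (.var y)) G, insert (.var x, A) Γ, insert (.var y, B) Δ⟩ →
      CutFreeDerivable Fr ⟨G, Γ, insert (z, .wand A B) Δ⟩
  | nEq {G Γ Δ} (w w' : Label) :
      EqJudgment G w w' →
      CutFreeDerivable Fr ⟨insert (.neq w w') G, Γ, Δ⟩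
  | em {G Γ Δ} (x y : Label) :
      CutFreeDerivable Fr ⟨insert (.eq x y) G, Γ, Δ⟩ →
      CutFreeDerivable Fr ⟨insert (.neq x y) G, Γ, Δ⟩ →
      CutFreeDerivable Fr ⟨G, Γ, Δ⟩
  /- The rule synthesised from the frame axiom `ax`. Here `θ` instantiates the universal variables
  by labels and `σ` the existential ones by pairwise distinct label variables that neither occur
  in the conclusion nor instantiate a universal variable. -/
  | struct {G Γ Δ} (ax : FrameAxiom) (θ : Fin ax.m → Label) (σ : Fin ax.n → ℕ) :
      ax ∈ Fr →
      Function.Injective σ →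
      (∀ j, Sequent.Fresh ⟨G ∪ (ax.ante.map (Atom.subst θ)).toFinset, Γ, Δ⟩ (σ j)) →
      (∀ i j, θ i ≠ .var (σ j)) →
      (∀ e ∈ ax.eqs, EqJudgment G (e.1.subst θ) (e.2.subst θ)) →
      CutFreeDerivable Fr
        ⟨G ∪ (ax.ante.map (Atom.subst θ)).toFinset ∪
          (ax.concl.map (Atom.subst (Sum.elim θ fun j => .var (σ j)))).toFinset, Γ, Δ⟩ →
      CutFreeDerivable Fr ⟨G ∪ (ax.ante.map (Atom.subst θ)).toFinset, Γ, Δ⟩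

end LSG

namespace LSG

/-! ### Terms and labels -/

/-! The proof is by failed proof search, with the rules read from conclusion to premises. If a rule
applies to an underivable sequent, one of its premises is underivable; since sequents are made of
sets, the principal formula can be kept, so that this premise extends the sequent. Starting from `⊢
w : F`, all such extensions are carried out along a directed family of underivable sequents
(`exists_saturated`, `exists_saturated_family`). Only countably many tasks arise: formulae are
restricted to the subformulae of `F`, labels are countable and `Fr` is finite.

The countermodel consists of the labels modulo the equalities occurring in the family. An equality,
or any other fact extracted from the family, involves finitely many atoms and hence already lives in
one member, where the underivability of that member can be used. By induction on formulae,
antecedent formulae are forced and succedent formulae are not (`Saturated.truth`).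

For a frame axiom, its antecedent has to be turned from truth about classes into atoms on labels
(`Saturated.exists_representatives`). The rule `EM` turns distinct classes into an atom `x ≠ y`. A
ternary atom true of classes dictates a representative for each of its arguments; these choices
never conflict because no variable occurs twice and `ε`, whose label is fixed, does not occur.
Equations need only hold up to the equality judgment and are insensitive to the choice. The
structural rule then supplies the conclusion (`Saturated.satisfies`). -/

instance : Countable Label := by
  refine Function.Injective.countable
    (f := fun t : Label => (match t with | .eps => none | .var v => some v : Option ℕ)) ?_
  rintro (_ | a) (_ | b) h <;> simp_all

/-- The finite set of subformulae of a formula. -/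
def Formula.subformulas {Var : Type*} [DecidableEq Var] : Formula Var → Finset (Formula Var)
  | .var p => {.var p}
  | .top => {.top}
  | .bot => {.bot}
  | .emp => {.emp}
  | .and A B => insert (.and A B) (A.subformulas ∪ B.subformulas)
  | .imp A B => insert (.imp A B) (A.subformulas ∪ B.subformulas)
  | .star A B => insert (.star A B) (A.subformulas ∪ B.subformulas)
  | .wand A B => insert (.wand A B) (A.subformulas ∪ B.subformulas)

theorem Formula.self_mem_subformulas {Var : Type*} [DecidableEq Var] (A : Formula Var) :
    A ∈ A.subformulas := by
  cases A <;> simp [Formula.subformulas]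

theorem EqJudgment.mono {G G' : Finset (Atom ℕ)} (h : G ⊆ G') {a b : Label}
    (hab : EqJudgment G a b) : EqJudgment G' a b :=
  Relation.EqvGen.mono (fun _ _ hr => h hr) a b hab

theorem Term.subst_congr {V W : Type*} {θ η : V → Term W} (t : Term V)
    (h : ∀ v ∈ t.vars, θ v = η v) : t.subst θ = t.subst η := by
  cases t with
  | eps => rfl
  | var v => exact h v (List.mem_singleton_self v)

theorem Atom.subst_congr {V W : Type*} {θ η : V → Term W} (T : Atom V)
    (h : ∀ v ∈ T.vars, θ v = η v) : T.subst θ = T.subst η := by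
  cases T <;> simp only [Atom.vars, List.mem_append] at h <;> simp only [Atom.subst] <;>
    congr 1 <;> exact Term.subst_congr _ fun v hv => h v (by simp [hv])

theorem Term.exists_bound_vars (t : Term ℕ) : ∃ N, ∀ a ≥ N, a ∉ t.vars := by
  cases t with
  | eps => exact ⟨0, by simp [Term.vars]⟩
  | var v => exact ⟨v + 1, fun a ha => by simp only [Term.vars, List.mem_singleton]; omega⟩

theorem Atom.exists_bound_vars (r : Atom ℕ) : ∃ N, ∀ a ≥ N, a ∉ r.vars := by
  cases r with
  | rel x y z =>
    obtain ⟨i, hi⟩ := x.exists_bound_vars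
    obtain ⟨j, hj⟩ := y.exists_bound_vars
    obtain ⟨k, hk⟩ := z.exists_bound_vars
    refine ⟨i + j + k, fun a ha => ?_⟩
    simp only [Atom.vars, List.mem_append, not_or]
    exact ⟨⟨hi a (by omega), hj a (by omega)⟩, hk a (by omega)⟩
  | eq x y | neq x y =>
    obtain ⟨i, hi⟩ := x.exists_bound_vars
    obtain ⟨j, hj⟩ := y.exists_bound_vars
    refine ⟨i + j, fun a ha => ?_⟩
    simp only [Atom.vars, List.mem_append, not_or]
    exact ⟨hi a (by omega), hj a (by omega)⟩

theorem exists_uniform_bound {α : Type*} (S : Finset α) (P : α → ℕ → Prop)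
    (h : ∀ x ∈ S, ∃ N, ∀ a ≥ N, P x a) : ∃ N, ∀ a ≥ N, ∀ x ∈ S, P x a := by
  have := (Filter.eventually_all_finset (l := Filter.atTop) S (p := fun x a => P x a)).2
    fun x hx => Filter.eventually_atTop.2 (h x hx)
  exact Filter.eventually_atTop.1 this

theorem Term.exists_bound_ne (t : Label) : ∃ N, ∀ a ≥ N, t ≠ .var a := by
  cases t with
  | eps => exact ⟨0, by simp⟩
  | var v => exact ⟨v + 1, fun a ha h => by injection h; omega⟩

section Calculus

variable {Var : Type*}

/-- All sufficiently large label variables are fresh. -/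
theorem Sequent.exists_bound_fresh (s : Sequent Var) : ∃ N, ∀ a ≥ N, s.Fresh a := by
  obtain ⟨i, hi⟩ := exists_uniform_bound s.G (fun r a => a ∉ r.vars)
    fun r _ => r.exists_bound_vars
  obtain ⟨j, hj⟩ := exists_uniform_bound s.Γ (fun f a => f.1 ≠ .var a)
    fun f _ => f.1.exists_bound_ne
  obtain ⟨k, hk⟩ := exists_uniform_bound s.Δ (fun f a => f.1 ≠ .var a)
    fun f _ => f.1.exists_bound_ne
  exact ⟨i + j + k, fun a ha => ⟨hi a (by omega), hj a (by omega), hk a (by omega)⟩⟩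

/-- Componentwise inclusion of sequents. -/
instance : Preorder (Sequent Var) :=
  Preorder.lift fun s => (s.G, s.Γ, s.Δ)

theorem Sequent.le_def {s t : Sequent Var} : s ≤ t ↔ s.G ⊆ t.G ∧ s.Γ ⊆ t.Γ ∧ s.Δ ⊆ t.Δ :=
  Iff.rfl

/-! ### Saturation along a countable family of requirements -/

/-- A property of sequents `Q` together with requirements indexed by a countable type that can
always be met by an extension satisfying `Q` has a directed family meeting all of them. -/
theorem exists_saturated {ι : Type*} [Countable ι] (Q : Sequent Var → Prop)
    (Req Done : ι → Sequent Var → Prop) (hmono : ∀ i, Monotone (Req i))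
    (hstep : ∀ i s, Q s → Req i s → ∃ s' ≥ s, Q s' ∧ Done i s') (s₀ : Sequent Var) (h₀ : Q s₀) :
    ∃ I : Set (Sequent Var), s₀ ∈ I ∧ DirectedOn (· ≤ ·) I ∧ (∀ s ∈ I, Q s) ∧
      ∀ i, ∀ s ∈ I, Req i s → ∃ s' ∈ I, Done i s' := by
  classical
  have := Encodable.ofCountable ι
  let D : ι → Order.Cofinal {s : Sequent Var // Q s} := fun i =>
    -- The second alternative makes the set cofinal even where requirement `i` never arises. An
    -- ideal meeting these countably many sets replaces a fair enumeration of the tasks.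
    { carrier := {s | Done i s.1 ∨ ∀ s' ≥ s, ¬ Req i s'.1}
      isCofinal := by
        intro s
        by_cases h : ∃ s' ≥ s, Req i s'.1
        · obtain ⟨s', hs', hr⟩ := h
          obtain ⟨t, ht, hQ, hd⟩ := hstep i s'.1 s'.2 hr
          exact ⟨⟨t, hQ⟩, Or.inl hd, le_trans hs' ht⟩
        · push Not at h
          exact ⟨s, Or.inr h, le_rfl⟩ }
  let J := Order.idealOfCofinals ⟨s₀, h₀⟩ D
  refine ⟨{s | ∃ h : Q s, ⟨s, h⟩ ∈ J}, ⟨h₀, Order.mem_idealOfCofinals _ _⟩, ?_,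
    fun s hs => hs.1, ?_⟩
  · rintro s ⟨hs, hsJ⟩ t ⟨ht, htJ⟩
    obtain ⟨u, hu, hsu, htu⟩ := J.directed _ hsJ _ htJ
    exact ⟨u.1, ⟨u.2, hu⟩, hsu, htu⟩
  · rintro i s ⟨hs, hsJ⟩ hr
    obtain ⟨t, htD, htJ⟩ := Order.cofinal_meets_idealOfCofinals ⟨s₀, h₀⟩ D i
    -- The requirement persists from `s` to the common bound `u`, which rules out the second
    -- alternative for `t`.
    obtain ⟨u, hu, hsu, htu⟩ := J.directed _ hsJ _ htJ
    rcases htD with hd | hn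
    · exact ⟨t.1, ⟨t.2, htJ⟩, hd⟩
    · exact absurd (hmono i hsu hr) (hn u htu)

/-! ### Analysing formulae in underivable sequents -/

/-- A labelled formula of the antecedent has been decomposed. -/
def DoneL (w : Label) : Formula Var → Sequent Var → Prop
  -- This requirement never arises: a sequent with `⊥` on the left is derivable.
  | .bot, _ => False
  | .emp, s => .eq w .eps ∈ s.G
  | .and A B, s => (w, A) ∈ s.Γ ∧ (w, B) ∈ s.Γ
  | .imp A B, s => (w, A) ∈ s.Δ ∨ (w, B) ∈ s.Γ
  | .star A B, s => ∃ x y : Label, .rel x y w ∈ s.G ∧ (x, A) ∈ s.Γ ∧ (y, B) ∈ s.Γ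
  -- A wand on the left is not decomposed once and for all; it is used anew with each ternary atom,
  -- through the task `wandL`. A star on the right is treated likewise.
  | _, _ => True

/-- A labelled formula of the succedent has been decomposed. -/
def DoneR (w : Label) : Formula Var → Sequent Var → Prop
  | .top, _ => False
  | .and A B, s => (w, A) ∈ s.Δ ∨ (w, B) ∈ s.Δ
  | .imp A B, s => (w, A) ∈ s.Γ ∧ (w, B) ∈ s.Δ
  | .wand A B, s => ∃ x y : Label, .rel x w y ∈ s.G ∧ (x, A) ∈ s.Γ ∧ (y, B) ∈ s.Δ
  | _, _ => True

variable {Fr : Set FrameAxiom}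

/-- The requirements to be met by a saturated family. -/
inductive Task (Fr : Set FrameAxiom) (S : Finset (Formula Var)) where
  | left (w : Label) (A : S)
  | right (w : Label) (A : S)
  | starR (x y z z' : Label) (A : S)
  | wandL (x y z z' : Label) (A : S)
  | em (x y : Label)
  | struct (ax : Fr) (θ : Fin ax.1.m → Label)

/-- `Var` may be uncountable, so countability depends on the restriction to the finite set `S`. -/
instance {S : Finset (Formula Var)} [Countable Fr] : Countable (Task Fr S) := by
  let f : Task Fr S → (Label × S) ⊕ (Label × S) ⊕ (Label × Label × Label × Label × S) ⊕
      (Label × Label × Label × Label × S) ⊕ (Label × Label) ⊕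
      (Σ ax : Fr, Fin ax.1.m → Label) := fun
    | .left w A => .inl (w, A)
    | .right w A => .inr (.inl (w, A))
    | .starR x y z z' A => .inr (.inr (.inl (x, y, z, z', A)))
    | .wandL x y z z' A => .inr (.inr (.inr (.inl (x, y, z, z', A))))
    | .em x y => .inr (.inr (.inr (.inr (.inl (x, y)))))
    | .struct ax θ => .inr (.inr (.inr (.inr (.inr ⟨ax, θ⟩))))
  refine Function.Injective.countable (f := f) ?_
  intro a b h
  cases a <;> cases b <;> simp_all [f]

/-- The situation in which a task has to be carried out. -/
def Task.Req {S : Finset (Formula Var)} : Task Fr S → Sequent Var → Prop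
  | .left w A, s => (w, A.1) ∈ s.Γ
  | .right w A, s => (w, A.1) ∈ s.Δ
  | .starR x y z z' A, s => .rel x y z' ∈ s.G ∧ EqJudgment s.G z z' ∧ (z, A.1) ∈ s.Δ
  | .wandL x y z z' A, s => .rel x z' y ∈ s.G ∧ EqJudgment s.G z z' ∧ (z, A.1) ∈ s.Γ
  | .em _ _, _ => True
  | .struct ax θ, s => (∀ S ∈ ax.1.ante, S.subst θ ∈ s.G) ∧
      ∀ e ∈ ax.1.eqs, EqJudgment s.G (e.1.subst θ) (e.2.subst θ)

/-- A task has been carried out. -/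
def Task.Done {S : Finset (Formula Var)} : Task Fr S → Sequent Var → Prop
  | .left w A, s => DoneL w A.1 s
  | .right w A, s => DoneR w A.1 s
  | .starR x y _ _ C, s => ∀ A B, C.1 = .star A B → (x, A) ∈ s.Δ ∨ (y, B) ∈ s.Δ
  | .wandL x y _ _ C, s => ∀ A B, C.1 = .wand A B → (x, A) ∈ s.Δ ∨ (y, B) ∈ s.Γ
  | .em x y, s => .eq x y ∈ s.G ∨ .neq x y ∈ s.G
  | .struct ax θ, s =>
      ∃ τ : Fin ax.1.n → Label, ∀ T ∈ ax.1.concl, T.subst (Sum.elim θ τ) ∈ s.G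

theorem Task.req_mono {S : Finset (Formula Var)} (t : Task Fr S) : Monotone t.Req := by
  rintro s s' ⟨hG, hΓ, hΔ⟩ h
  cases t with
  | left w A => exact hΓ h
  | right w A => exact hΔ h
  | starR x y z z' A => exact ⟨hG h.1, h.2.1.mono hG, hΔ h.2.2⟩
  | wandL x y z z' A => exact ⟨hG h.1, h.2.1.mono hG, hΓ h.2.2⟩
  | em x y => trivial
  | struct ax θ => exact ⟨fun S hS => hG (h.1 S hS), fun e he => (h.2 e he).mono hG⟩

/-! ### The canonical model -/

/-- Equality of labels according to a family of sequents. -/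
def labelSetoid (I : Set (Sequent Var)) : Setoid Label :=
  Relation.EqvGen.setoid fun a b => ∃ s ∈ I, .eq a b ∈ s.G

/-- The model of labels modulo provable equality. -/
def canonicalModel (I : Set (Sequent Var)) : KripkeModel Var where
  World := Quotient (labelSetoid I)
  R a b c := ∃ x y z : Label, (∃ s ∈ I, .rel x y z ∈ s.G) ∧
    Quotient.mk _ x = a ∧ Quotient.mk _ y = b ∧ Quotient.mk _ z = c
  unit := Quotient.mk _ .eps
  val p := {a | ∃ x : Label, (∃ s ∈ I, (x, .var p) ∈ s.Γ) ∧ Quotient.mk _ x = a}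

/-- The world of the canonical model denoted by a label. -/
def world (I : Set (Sequent Var)) (x : Label) : (canonicalModel I).World :=
  Quotient.mk (labelSetoid I) x

theorem world_surjective (I : Set (Sequent Var)) : Function.Surjective (world I) :=
  Quotient.exists_rep

theorem eval_world (I : Set (Sequent Var)) {V : Type*} (θ : V → Label) (t : Term V) :
    t.eval (canonicalModel I).toKripkeFrame (fun v => world I (θ v)) = world I (t.subst θ) := by
  cases t <;> rfl

theorem world_eq_of_mem {I : Set (Sequent Var)} {x y : Label} {s : Sequent Var} (hs : s ∈ I) (h : .eq x y ∈ s.G) :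
    world I x = world I y :=
  Quotient.sound (Relation.EqvGen.rel _ _ ⟨s, hs, h⟩)

variable [DecidableEq Var]

/-! ### Extending underivable sequents -/

theorem exists_doneL (w : Label) (A : Formula Var) (s : Sequent Var)
    (hs : ¬ CutFreeDerivable Fr s) (hA : (w, A) ∈ s.Γ) :
    ∃ s' ≥ s, ¬ CutFreeDerivable Fr s' ∧ DoneL w A s' := by
  obtain ⟨G, Γ, Δ⟩ := s
  -- The side formulae of each rule are taken to be all of `Γ`, principal formula included, so that
  -- every premise extends the conclusion.
  have hΓ : insert (w, A) Γ = Γ := Finset.insert_eq_of_mem hA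
  cases A with
  | var p => exact ⟨_, le_rfl, hs, trivial⟩
  | top => exact ⟨_, le_rfl, hs, trivial⟩
  | wand A B => exact ⟨_, le_rfl, hs, trivial⟩
  | bot => exact absurd (hΓ ▸ CutFreeDerivable.botL w) hs
  | emp =>
    refine ⟨⟨insert (.eq w .eps) G, Γ, Δ⟩, ⟨by simp, by simp⟩, fun h => hs ?_, by simp [DoneL]⟩
    exact hΓ ▸ CutFreeDerivable.empL w h
  | and A B =>
    refine ⟨⟨G, insert (w, A) (insert (w, B) Γ), Δ⟩, Sequent.le_def.2 ⟨by simp, ?_, by simp⟩,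
      fun h => hs ?_, by simp [DoneL]⟩
    · exact (Finset.subset_insert _ _).trans (Finset.subset_insert _ _)
    · exact hΓ ▸ CutFreeDerivable.andL w A B h
  | imp A B =>
    by_cases h : CutFreeDerivable Fr ⟨G, Γ, insert (w, A) Δ⟩
    · refine ⟨⟨G, insert (w, B) Γ, Δ⟩, Sequent.le_def.2 (by simp), fun h' => hs ?_,
        by simp [DoneL]⟩
      exact hΓ ▸ CutFreeDerivable.impL w A B h h'
    · exact ⟨_, Sequent.le_def.2 (by simp), h, by simp [DoneL]⟩
  | star A B =>
    obtain ⟨N, hN⟩ := Sequent.exists_bound_fresh (Var := Var) ⟨G, Γ, Δ⟩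
    refine ⟨⟨insert (.rel (.var N) (.var (N + 1)) w) G,
      insert (.var N, A) (insert (.var (N + 1), B) Γ), Δ⟩,
      Sequent.le_def.2 ⟨by simp, ?_, by simp⟩, fun h => hs ?_,
      ⟨.var N, .var (N + 1), by simp, by simp, by simp⟩⟩
    · exact (Finset.subset_insert _ _).trans (Finset.subset_insert _ _)
    · have := CutFreeDerivable.starL (Γ := Γ) w A B N (N + 1) (by omega)
        (by rw [hΓ]; exact hN _ le_rfl) (by rw [hΓ]; exact hN _ (by omega)) h
      rwa [hΓ] at this

theorem exists_doneR (w : Label) (A : Formula Var) (s : Sequent Var)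
    (hs : ¬ CutFreeDerivable Fr s) (hA : (w, A) ∈ s.Δ) :
    ∃ s' ≥ s, ¬ CutFreeDerivable Fr s' ∧ DoneR w A s' := by
  obtain ⟨G, Γ, Δ⟩ := s
  have hΔ : insert (w, A) Δ = Δ := Finset.insert_eq_of_mem hA
  cases A with
  | var p => exact ⟨_, le_rfl, hs, trivial⟩
  | bot => exact ⟨_, le_rfl, hs, trivial⟩
  | emp => exact ⟨_, le_rfl, hs, trivial⟩
  | star A B => exact ⟨_, le_rfl, hs, trivial⟩
  | top => exact absurd (hΔ ▸ CutFreeDerivable.topR w) hs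
  | and A B =>
    by_cases h : CutFreeDerivable Fr ⟨G, Γ, insert (w, A) Δ⟩
    · refine ⟨⟨G, Γ, insert (w, B) Δ⟩, Sequent.le_def.2 (by simp), fun h' => hs ?_,
        by simp [DoneR]⟩
      exact hΔ ▸ CutFreeDerivable.andR w A B h h'
    · exact ⟨_, Sequent.le_def.2 (by simp), h, by simp [DoneR]⟩
  | imp A B =>
    refine ⟨⟨G, insert (w, A) Γ, insert (w, B) Δ⟩, Sequent.le_def.2 (by simp),
      fun h => hs ?_, by simp [DoneR]⟩
    exact hΔ ▸ CutFreeDerivable.impR w A B h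
  | wand A B =>
    obtain ⟨N, hN⟩ := Sequent.exists_bound_fresh (Var := Var) ⟨G, Γ, Δ⟩
    refine ⟨⟨insert (.rel (.var N) w (.var (N + 1))) G,
      insert (.var N, A) Γ, insert (.var (N + 1), B) Δ⟩,
      Sequent.le_def.2 (by simp), fun h => hs ?_,
      ⟨.var N, .var (N + 1), by simp, by simp, by simp⟩⟩
    have := CutFreeDerivable.wandR (Δ := Δ) w A B N (N + 1) (by omega)
      (by rw [hΔ]; exact hN _ le_rfl) (by rw [hΔ]; exact hN _ (by omega)) h
    rwa [hΔ] at this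

theorem exists_starR (x y z z' : Label) (A B : Formula Var) (s : Sequent Var)
    (hs : ¬ CutFreeDerivable Fr s) (hr : .rel x y z' ∈ s.G) (he : EqJudgment s.G z z')
    (hA : (z, .star A B) ∈ s.Δ) :
    ∃ s' ≥ s, ¬ CutFreeDerivable Fr s' ∧ ((x, A) ∈ s'.Δ ∨ (y, B) ∈ s'.Δ) := by
  obtain ⟨G, Γ, Δ⟩ := s
  have hG : insert (.rel x y z') G = G := Finset.insert_eq_of_mem hr
  have hΔ : insert (z, .star A B) Δ = Δ := Finset.insert_eq_of_mem hA
  by_cases h : CutFreeDerivable Fr ⟨G, Γ, insert (x, A) Δ⟩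
  · refine ⟨⟨G, Γ, insert (y, B) Δ⟩, Sequent.le_def.2 (by simp), fun h' => hs ?_, by simp⟩
    have := CutFreeDerivable.starR (Fr := Fr) (G := G) (Γ := Γ) (Δ := Δ) x y z z' A B he
    rw [hG, hΔ] at this
    exact this h h'
  · exact ⟨_, Sequent.le_def.2 (by simp), h, by simp⟩

theorem exists_wandL (x y z z' : Label) (A B : Formula Var) (s : Sequent Var)
    (hs : ¬ CutFreeDerivable Fr s) (hr : .rel x z' y ∈ s.G) (he : EqJudgment s.G z z')
    (hA : (z, .wand A B) ∈ s.Γ) :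
    ∃ s' ≥ s, ¬ CutFreeDerivable Fr s' ∧ ((x, A) ∈ s'.Δ ∨ (y, B) ∈ s'.Γ) := by
  obtain ⟨G, Γ, Δ⟩ := s
  have hG : insert (.rel x z' y) G = G := Finset.insert_eq_of_mem hr
  have hΓ : insert (z, .wand A B) Γ = Γ := Finset.insert_eq_of_mem hA
  by_cases h : CutFreeDerivable Fr ⟨G, Γ, insert (x, A) Δ⟩
  · refine ⟨⟨G, insert (y, B) Γ, Δ⟩, Sequent.le_def.2 (by simp), fun h' => hs ?_, by simp⟩
    have := CutFreeDerivable.wandL (Fr := Fr) (G := G) (Γ := Γ) (Δ := Δ) x y z z' A B he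
    rw [hG, hΓ] at this
    exact this h h'
  · exact ⟨_, Sequent.le_def.2 (by simp), h, by simp⟩

theorem exists_em (x y : Label) (s : Sequent Var) (hs : ¬ CutFreeDerivable Fr s) :
    ∃ s' ≥ s, ¬ CutFreeDerivable Fr s' ∧ (.eq x y ∈ s'.G ∨ .neq x y ∈ s'.G) := by
  obtain ⟨G, Γ, Δ⟩ := s
  by_cases h : CutFreeDerivable Fr ⟨insert (.eq x y) G, Γ, Δ⟩
  · exact ⟨⟨insert (.neq x y) G, Γ, Δ⟩, Sequent.le_def.2 (by simp),
      fun h' => hs (.em x y h h'), by simp⟩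
  · exact ⟨_, Sequent.le_def.2 (by simp), h, by simp⟩

theorem exists_struct (ax : FrameAxiom) (hax : ax ∈ Fr) (θ : Fin ax.m → Label) (s : Sequent Var)
    (hs : ¬ CutFreeDerivable Fr s) (hante : ∀ S ∈ ax.ante, S.subst θ ∈ s.G)
    (heqs : ∀ e ∈ ax.eqs, EqJudgment s.G (e.1.subst θ) (e.2.subst θ)) :
    ∃ s' ≥ s, ¬ CutFreeDerivable Fr s' ∧
      ∃ τ : Fin ax.n → Label, ∀ T ∈ ax.concl, T.subst (Sum.elim θ τ) ∈ s'.G := by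
  obtain ⟨G, Γ, Δ⟩ := s
  have hG : G ∪ (ax.ante.map (Atom.subst θ)).toFinset = G := by
    refine Finset.union_eq_left.2 fun r hr => ?_
    obtain ⟨S, hS, rfl⟩ := List.mem_map.1 (List.mem_toFinset.1 hr)
    exact hante S hS
  obtain ⟨N, hN⟩ := Sequent.exists_bound_fresh (Var := Var) ⟨G, Γ, Δ⟩
  obtain ⟨M, hM⟩ := exists_uniform_bound Finset.univ (fun i a => θ i ≠ .var a)
    fun i _ => (θ i).exists_bound_ne
  -- From `N` on, variables are fresh for the sequent; from `M` on, they differ from the labels `θ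
  -- i`, which need not occur in it. The offset `j` makes `σ` injective.
  let σ : Fin ax.n → ℕ := fun j => N + M + j
  refine ⟨⟨G ∪ (ax.concl.map (Atom.subst (Sum.elim θ fun j => .var (σ j)))).toFinset, Γ, Δ⟩,
    Sequent.le_def.2 (by simp), fun h => hs ?_, fun j => .var (σ j), fun T hT => ?_⟩
  · have := CutFreeDerivable.struct (Fr := Fr) (G := G) (Γ := Γ) (Δ := Δ) ax θ σ hax
      (fun i j hij => Fin.ext (by simp only [σ] at hij; omega))
      (fun j => by rw [hG]; exact hN _ (by simp only [σ]; omega))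
      (fun i j => hM _ (by simp only [σ]; omega) i (Finset.mem_univ i)) heqs
    rw [hG] at this
    exact this h
  · exact Finset.mem_union_right _ (List.mem_toFinset.2 (List.mem_map_of_mem hT))

/-! ### Saturated directed families of underivable sequents -/

/-- A directed family of underivable sequents, closed under the rules as far as formulae from `S`
are concerned. -/
structure Saturated (Fr : Set FrameAxiom) (S : Finset (Formula Var)) (I : Set (Sequent Var)) :
    Prop where
  nonempty : I.Nonempty
  directed : DirectedOn (· ≤ ·) I
  underivable : ∀ s ∈ I, ¬ CutFreeDerivable Fr s
  left : ∀ w, ∀ A ∈ S, ∀ s ∈ I, (w, A) ∈ s.Γ → ∃ s' ∈ I, DoneL w A s'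
  right : ∀ w, ∀ A ∈ S, ∀ s ∈ I, (w, A) ∈ s.Δ → ∃ s' ∈ I, DoneR w A s'
  starR : ∀ x y z z' A B, .star A B ∈ S → ∀ s ∈ I, .rel x y z' ∈ s.G → EqJudgment s.G z z' →
    (z, .star A B) ∈ s.Δ → ∃ s' ∈ I, (x, A) ∈ s'.Δ ∨ (y, B) ∈ s'.Δ
  wandL : ∀ x y z z' A B, .wand A B ∈ S → ∀ s ∈ I, .rel x z' y ∈ s.G → EqJudgment s.G z z' →
    (z, .wand A B) ∈ s.Γ → ∃ s' ∈ I, (x, A) ∈ s'.Δ ∨ (y, B) ∈ s'.Γ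
  em : ∀ x y, ∃ s ∈ I, .eq x y ∈ s.G ∨ .neq x y ∈ s.G
  struct : ∀ ax ∈ Fr, ∀ θ : Fin ax.m → Label, ∀ s ∈ I, (∀ S ∈ ax.ante, S.subst θ ∈ s.G) →
    (∀ e ∈ ax.eqs, EqJudgment s.G (e.1.subst θ) (e.2.subst θ)) →
    ∃ s' ∈ I, ∃ τ : Fin ax.n → Label, ∀ T ∈ ax.concl, T.subst (Sum.elim θ τ) ∈ s'.G

theorem Task.exists_done {S : Finset (Formula Var)} (t : Task Fr S) (s : Sequent Var)
    (hs : ¬ CutFreeDerivable Fr s) (hr : t.Req s) :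
    ∃ s' ≥ s, ¬ CutFreeDerivable Fr s' ∧ t.Done s' := by
  cases t with
  | left w A => exact exists_doneL w A.1 s hs hr
  | right w A => exact exists_doneR w A.1 s hs hr
  | starR x y z z' C =>
    obtain ⟨C, hC⟩ := C
    by_cases h : ∃ A B, C = .star A B
    · obtain ⟨A, B, rfl⟩ := h
      obtain ⟨s', hle, hs', hd⟩ := exists_starR x y z z' A B s hs hr.1 hr.2.1 hr.2.2
      refine ⟨s', hle, hs', fun A' B' h => ?_⟩
      obtain ⟨rfl, rfl⟩ := Formula.star.inj h
      exact hd
    · exact ⟨s, le_rfl, hs, fun A B hAB => absurd ⟨A, B, hAB⟩ h⟩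
  | wandL x y z z' C =>
    obtain ⟨C, hC⟩ := C
    by_cases h : ∃ A B, C = .wand A B
    · obtain ⟨A, B, rfl⟩ := h
      obtain ⟨s', hle, hs', hd⟩ := exists_wandL x y z z' A B s hs hr.1 hr.2.1 hr.2.2
      refine ⟨s', hle, hs', fun A' B' h => ?_⟩
      obtain ⟨rfl, rfl⟩ := Formula.wand.inj h
      exact hd
    · exact ⟨s, le_rfl, hs, fun A B hAB => absurd ⟨A, B, hAB⟩ h⟩
  | em x y => exact exists_em x y s hs
  | struct ax θ => exact exists_struct ax.1 ax.2 θ s hs hr.1 hr.2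

/-- Every underivable sequent belongs to a saturated family. -/
theorem exists_saturated_family [Countable Fr] (S : Finset (Formula Var)) (s₀ : Sequent Var)
    (h₀ : ¬ CutFreeDerivable Fr s₀) : ∃ I, Saturated Fr S I ∧ s₀ ∈ I := by
  obtain ⟨I, hI₀, hdir, hund, hdone⟩ := exists_saturated (ι := Task Fr S)
    (fun s => ¬ CutFreeDerivable Fr s) Task.Req Task.Done Task.req_mono Task.exists_done s₀ h₀
  refine ⟨I, ⟨⟨s₀, hI₀⟩, hdir, hund, ?_, ?_, ?_, ?_, ?_, ?_⟩, hI₀⟩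
  · exact fun w A hA s hs h => hdone (.left w ⟨A, hA⟩) s hs h
  · exact fun w A hA s hs h => hdone (.right w ⟨A, hA⟩) s hs h
  · intro x y z z' A B hS s hs hr he h
    obtain ⟨s', hs', hd⟩ := hdone (.starR x y z z' ⟨_, hS⟩) s hs ⟨hr, he, h⟩
    exact ⟨s', hs', hd A B rfl⟩
  · intro x y z z' A B hS s hs hr he h
    obtain ⟨s', hs', hd⟩ := hdone (.wandL x y z z' ⟨_, hS⟩) s hs ⟨hr, he, h⟩
    exact ⟨s', hs', hd A B rfl⟩
  · exact fun x y => hdone (.em x y) s₀ hI₀ trivial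
  · exact fun ax hax θ s hs hS he => hdone (.struct ⟨ax, hax⟩ θ) s hs ⟨hS, he⟩

/-! ### Correctness of the canonical model -/

namespace Saturated

variable {S : Finset (Formula Var)} {I : Set (Sequent Var)}

/-- A chain of equalities uses finitely many atoms, and directedness collects them in one member. -/
theorem exists_eqJudgment (h : Saturated Fr S I) {x y : Label} (heq : world I x = world I y) :
    ∃ s ∈ I, EqJudgment s.G x y := by
  have hxy : Relation.EqvGen (fun a b => ∃ s ∈ I, .eq a b ∈ s.G) x y := Quotient.exact heq
  clear heq
  induction hxy with
  | rel a b hab =>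
    obtain ⟨s, hs, hr⟩ := hab
    exact ⟨s, hs, .rel _ _ hr⟩
  | refl a =>
    obtain ⟨s, hs⟩ := h.nonempty
    exact ⟨s, hs, .refl _⟩
  | symm a b _ ih =>
    obtain ⟨s, hs, hr⟩ := ih
    exact ⟨s, hs, .symm _ _ hr⟩
  | trans a b c _ _ ih₁ ih₂ =>
    obtain ⟨s, hs, hr⟩ := ih₁
    obtain ⟨t, ht, hr'⟩ := ih₂
    obtain ⟨u, hu, hsu, htu⟩ := h.directed s hs t ht
    exact ⟨u, hu, .trans _ _ _ (EqJudgment.mono hsu.1 hr) (EqJudgment.mono htu.1 hr')⟩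

theorem world_ne_of_mem (h : Saturated Fr S I) {x y : Label} {s : Sequent Var} (hs : s ∈ I)
    (hn : .neq x y ∈ s.G) : world I x ≠ world I y := by
  intro hxy
  obtain ⟨t, ht, he⟩ := h.exists_eqJudgment hxy
  obtain ⟨⟨G, Γ, Δ⟩, hu, hsu, htu⟩ := h.directed s hs t ht
  have := CutFreeDerivable.nEq (Fr := Fr) (Γ := Γ) (Δ := Δ) x y (he.mono htu.1)
  rw [Finset.insert_eq_of_mem (hsu.1 hn)] at this
  exact h.underivable _ hu this

/-- This is the purpose of `EM`: the family decides every equation between labels. -/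
theorem exists_neq_mem (h : Saturated Fr S I) {x y : Label} (hxy : world I x ≠ world I y) :
    ∃ s ∈ I, .neq x y ∈ s.G := by
  obtain ⟨s, hs, he | hn⟩ := h.em x y
  · exact absurd (world_eq_of_mem hs he) hxy
  · exact ⟨s, hs, hn⟩

theorem exists_upper_bound (h : Saturated Fr S I) {α : Type*} (l : List α)
    (P : α → Sequent Var → Prop) (hmono : ∀ a, Monotone (P a))
    (hP : ∀ a ∈ l, ∃ s ∈ I, P a s) : ∃ s ∈ I, ∀ a ∈ l, P a s := by
  induction l with
  | nil =>
    obtain ⟨s, hs⟩ := h.nonempty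
    exact ⟨s, hs, by simp⟩
  | cons a l ih =>
    obtain ⟨s, hs, hsl⟩ := ih fun b hb => hP b (List.mem_cons_of_mem _ hb)
    obtain ⟨t, ht, hta⟩ := hP a List.mem_cons_self
    obtain ⟨u, hu, hsu, htu⟩ := h.directed s hs t ht
    refine ⟨u, hu, fun b hb => ?_⟩
    rcases List.mem_cons.1 hb with rfl | hb
    · exact hmono _ htu hta
    · exact hmono _ hsu (hsl b hb)

theorem holds_of_mem (h : Saturated Fr S I) {V : Type*} (θ : V → Label) (T : Atom V)
    {s : Sequent Var} (hs : s ∈ I) (hT : T.subst θ ∈ s.G) :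
    T.Holds (canonicalModel I).toKripkeFrame (fun v => world I (θ v)) := by
  cases T with
  | rel x y z =>
    simp only [Atom.Holds, eval_world]
    exact ⟨_, _, _, ⟨s, hs, hT⟩, rfl, rfl, rfl⟩
  | eq x y =>
    simp only [Atom.Holds, eval_world]
    exact world_eq_of_mem hs hT
  | neq x y =>
    simp only [Atom.Holds, eval_world]
    exact h.world_ne_of_mem hs hT

/-- For an inequality any representatives will do. A ternary atom true of classes only provides some
labels `x`, `y`, `z` in an atom of the family; `θ` can take these values because the arguments are
three distinct variables. -/
theorem exists_representatives_atom (h : Saturated Fr S I) {m : ℕ}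
    (μ : Fin m → (canonicalModel I).World) (T : Atom (Fin m)) (hform : T.IsAntecedent)
    (hlin : T.vars.Nodup) (hT : T.Holds (canonicalModel I).toKripkeFrame μ) :
    ∃ θ : Fin m → Label, (∀ i, world I (θ i) = μ i) ∧ ∃ s ∈ I, T.subst θ ∈ s.G := by
  choose θ hθ using fun i => world_surjective I (μ i)
  cases T with
  | eq x y => exact hform.elim
  | neq x y =>
    refine ⟨θ, hθ, h.exists_neq_mem ?_⟩
    obtain rfl : (fun i => world I (θ i)) = μ := funext hθ
    simpa only [Atom.Holds, eval_world] using hT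
  | rel x y z =>
    obtain ⟨hx, hy, hz⟩ := hform
    cases x with | eps => exact (hx rfl).elim | var a => ?_
    cases y with | eps => exact (hy rfl).elim | var b => ?_
    cases z with | eps => exact (hz rfl).elim | var c => ?_
    obtain ⟨x, y, z, ⟨s, hs, hr⟩, hxa, hyb, hzc⟩ := hT
    simp only [Atom.vars, Term.vars, List.cons_append, List.nil_append, List.nodup_cons,
      List.mem_cons, List.not_mem_nil, or_false, not_or] at hlin
    obtain ⟨⟨hab, hac⟩, hbc, -⟩ := hlin
    refine ⟨fun i => if i = a then x else if i = b then y else if i = c then z else θ i,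
      fun i => ?_, s, hs, ?_⟩
    · dsimp only
      split_ifs with h₁ h₂ h₃
      · exact h₁ ▸ hxa
      · exact h₂ ▸ hyb
      · exact h₃ ▸ hzc
      · exact hθ i
    · simpa [Atom.subst, Term.subst, Ne.symm hab, Ne.symm hac, Ne.symm hbc] using hr

/-- If no variable occurs twice in a list of antecedent atoms that hold in the canonical model,
representatives of their values can be chosen for which all of the atoms occur in the family. -/
theorem exists_representatives (h : Saturated Fr S I) {m : ℕ}
    (μ : Fin m → (canonicalModel I).World) (l : List (Atom (Fin m)))
    (hform : ∀ S ∈ l, S.IsAntecedent) (hlin : (l.flatMap Atom.vars).Nodup)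
    (hl : ∀ S ∈ l, S.Holds (canonicalModel I).toKripkeFrame μ) :
    ∃ θ : Fin m → Label, (∀ i, world I (θ i) = μ i) ∧
      ∀ S ∈ l, ∃ s ∈ I, S.subst θ ∈ s.G := by
  induction l with
  | nil =>
    choose θ hθ using fun i => world_surjective I (μ i)
    exact ⟨θ, hθ, by simp⟩
  | cons S l ih =>
    rw [List.flatMap_cons, List.nodup_append'] at hlin
    obtain ⟨hS, hl', hdisj⟩ := hlin
    obtain ⟨θ, hθ, hm⟩ := ih (fun T hT => hform T (List.mem_cons_of_mem _ hT)) hl'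
      fun T hT => hl T (List.mem_cons_of_mem _ hT)
    obtain ⟨η, hη, s, hs, hSs⟩ := h.exists_representatives_atom μ S (hform S List.mem_cons_self)
      hS (hl S List.mem_cons_self)
    -- The two choices are glued; by linearity the variables of `S` are absent from `l`, so the
    -- atoms of `l` still see only `θ`.
    refine ⟨fun i => if i ∈ S.vars then η i else θ i, fun i => ?_, fun T hT => ?_⟩
    · dsimp only
      split_ifs
      exacts [hη i, hθ i]
    · rcases List.mem_cons.1 hT with rfl | hT
      · refine ⟨s, hs, ?_⟩
        rwa [T.subst_congr (η := η) fun v hv => if_pos hv]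
      · obtain ⟨t, ht, hTt⟩ := hm T hT
        refine ⟨t, ht, ?_⟩
        rwa [T.subst_congr (η := θ) fun v hv =>
          if_neg fun hv' => hdisj hv' (List.mem_flatMap.2 ⟨T, hT, hv⟩)]

/-- Representatives are chosen to suit the atoms `S_i` alone: equality of classes makes the
equations judged for any choice. One member contains the whole instantiated antecedent, and the
labels given by its structural rule name the existential witnesses. -/
theorem satisfies (h : Saturated Fr S I) (ax : FrameAxiom) (hax : ax ∈ Fr) :
    (canonicalModel I).toKripkeFrame.Satisfies ax := by
  intro μ heqs hante
  obtain ⟨θ, hθ, hmem⟩ := h.exists_representatives μ ax.ante ax.ante_form ax.ante_linear hante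
  obtain rfl : (fun i => world I (θ i)) = μ := funext hθ
  obtain ⟨s, hs, hsa⟩ := h.exists_upper_bound ax.ante (fun S s => S.subst θ ∈ s.G)
    (fun _ _ _ hle hm => hle.1 hm) hmem
  obtain ⟨t, ht, hte⟩ := h.exists_upper_bound ax.eqs
    (fun e s => EqJudgment s.G (e.1.subst θ) (e.2.subst θ))
    (fun _ _ _ hle hm => EqJudgment.mono hle.1 hm) fun e he => h.exists_eqJudgment (by
      simpa only [eval_world] using heqs e he)
  obtain ⟨u, hu, hsu, htu⟩ := h.directed s hs t ht
  obtain ⟨v, hv, τ, hτ⟩ := h.struct ax hax θ u hu (fun S hS => hsu.1 (hsa S hS))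
    fun e he => (hte e he).mono htu.1
  refine ⟨fun j => world I (τ j), fun T hT => ?_⟩
  convert h.holds_of_mem (Sum.elim θ τ) T hv (hτ T hT) using 1
  ext (i | j) <;> rfl

/-- Formulae of the antecedents are forced, formulae of the succedents are not. -/
theorem truth (h : Saturated Fr S I) (A : Formula Var) (hA : A.subformulas ⊆ S) (w : Label) :
    (∀ s ∈ I, (w, A) ∈ s.Γ → (canonicalModel I).Forces (world I w) A) ∧
      ∀ s ∈ I, (w, A) ∈ s.Δ → ¬ (canonicalModel I).Forces (world I w) A := by
  have hAS : A ∈ S := hA A.self_mem_subformulas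
  induction A generalizing w with
  | var p =>
    refine ⟨fun s hs hm => ⟨w, ⟨s, hs, hm⟩, rfl⟩, ?_⟩
    -- The valuation may hold because of another label `x` of the same class; `id` modulo equality
    -- closes the common bound.
    rintro s hs hm ⟨x, ⟨t, ht, hx⟩, hxw⟩
    obtain ⟨u, hu, he⟩ := h.exists_eqJudgment hxw
    obtain ⟨v, hv, hsv, htv⟩ := h.directed s hs t ht
    obtain ⟨⟨G, Γ, Δ⟩, hr, hvr, hur⟩ := h.directed v hv u hu
    have := CutFreeDerivable.id (Fr := Fr) (Γ := Γ) (Δ := Δ) x w p (he.mono hur.1)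
    rw [Finset.insert_eq_of_mem (hvr.2.1 (htv.2.1 hx)),
      Finset.insert_eq_of_mem (hvr.2.2 (hsv.2.2 hm))] at this
    exact h.underivable _ hr this
  | top =>
    refine ⟨fun _ _ _ => trivial, fun s hs hm => ?_⟩
    obtain ⟨_, _, hf⟩ := h.right w _ hAS s hs hm
    exact hf.elim
  | bot =>
    refine ⟨fun s hs hm => ?_, fun _ _ _ hf => hf⟩
    obtain ⟨_, _, hf⟩ := h.left w _ hAS s hs hm
    exact hf.elim
  | emp =>
    refine ⟨fun s hs hm => ?_, fun s hs hm hf => ?_⟩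
    · obtain ⟨t, ht, he⟩ := h.left w _ hAS s hs hm
      exact world_eq_of_mem ht he
    · obtain ⟨t, ht, he⟩ := h.exists_eqJudgment (y := .eps) hf
      obtain ⟨⟨G, Γ, Δ⟩, hu, hsu, htu⟩ := h.directed s hs t ht
      have := CutFreeDerivable.empR (Fr := Fr) (Γ := Γ) (Δ := Δ) w (he.mono htu.1)
      rw [Finset.insert_eq_of_mem (hsu.2.2 hm)] at this
      exact h.underivable _ hu this
  | and A B ihA ihB =>
    have hS : A.subformulas ⊆ S ∧ B.subformulas ⊆ S := by
      rw [Formula.subformulas, Finset.insert_subset_iff, Finset.union_subset_iff] at hA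
      exact hA.2
    replace ihA := fun w => ihA hS.1 w (hS.1 A.self_mem_subformulas)
    replace ihB := fun w => ihB hS.2 w (hS.2 B.self_mem_subformulas)
    refine ⟨fun s hs hm => ?_, fun s hs hm hf => ?_⟩
    · obtain ⟨t, ht, h₁, h₂⟩ := h.left w _ hAS s hs hm
      exact ⟨(ihA w).1 t ht h₁, (ihB w).1 t ht h₂⟩
    · obtain ⟨t, ht, h₁ | h₂⟩ := h.right w _ hAS s hs hm
      · exact (ihA w).2 t ht h₁ hf.1
      · exact (ihB w).2 t ht h₂ hf.2
  | imp A B ihA ihB =>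
    have hS : A.subformulas ⊆ S ∧ B.subformulas ⊆ S := by
      rw [Formula.subformulas, Finset.insert_subset_iff, Finset.union_subset_iff] at hA
      exact hA.2
    replace ihA := fun w => ihA hS.1 w (hS.1 A.self_mem_subformulas)
    replace ihB := fun w => ihB hS.2 w (hS.2 B.self_mem_subformulas)
    refine ⟨fun s hs hm hf => ?_, fun s hs hm hf => ?_⟩
    · obtain ⟨t, ht, h₁ | h₂⟩ := h.left w _ hAS s hs hm
      · exact ((ihA w).2 t ht h₁ hf).elim
      · exact (ihB w).1 t ht h₂
    · obtain ⟨t, ht, h₁, h₂⟩ := h.right w _ hAS s hs hm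
      exact (ihB w).2 t ht h₂ (hf ((ihA w).1 t ht h₁))
  | star A B ihA ihB =>
    have hS : A.subformulas ⊆ S ∧ B.subformulas ⊆ S := by
      rw [Formula.subformulas, Finset.insert_subset_iff, Finset.union_subset_iff] at hA
      exact hA.2
    replace ihA := fun w => ihA hS.1 w (hS.1 A.self_mem_subformulas)
    replace ihB := fun w => ihB hS.2 w (hS.2 B.self_mem_subformulas)
    refine ⟨fun s hs hm => ?_, ?_⟩
    · obtain ⟨t, ht, x, y, hr, hx, hy⟩ := h.left w _ hAS s hs hm
      exact ⟨world I x, world I y, ⟨x, y, w, ⟨t, ht, hr⟩, rfl, rfl, rfl⟩,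
        (ihA x).1 t ht hx, (ihB y).1 t ht hy⟩
    · rintro s hs hm ⟨_, _, ⟨x, y, z, ⟨t, ht, hr⟩, rfl, rfl, hz⟩, hfx, hfy⟩
      -- The ternary atom ends in `z`, which is only equal to `w` in the quotient; the side
      -- condition of `*R` absorbs the difference without substitution.
      obtain ⟨u, hu, he⟩ := h.exists_eqJudgment (x := w) (y := z) hz.symm
      obtain ⟨v, hv, hsv, htv⟩ := h.directed s hs t ht
      obtain ⟨r, hr', hvr, hur⟩ := h.directed v hv u hu
      obtain ⟨q, hq, h₁ | h₂⟩ := h.starR x y w z A B hAS r hr' (hvr.1 (htv.1 hr))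
        (he.mono hur.1) (hvr.2.2 (hsv.2.2 hm))
      · exact (ihA x).2 q hq h₁ hfx
      · exact (ihB y).2 q hq h₂ hfy
  | wand A B ihA ihB =>
    have hS : A.subformulas ⊆ S ∧ B.subformulas ⊆ S := by
      rw [Formula.subformulas, Finset.insert_subset_iff, Finset.union_subset_iff] at hA
      exact hA.2
    replace ihA := fun w => ihA hS.1 w (hS.1 A.self_mem_subformulas)
    replace ihB := fun w => ihB hS.2 w (hS.2 B.self_mem_subformulas)
    refine ⟨?_, fun s hs hm hf => ?_⟩
    · rintro s hs hm _ _ ⟨x, z, y, ⟨t, ht, hr⟩, rfl, hz, rfl⟩ hfx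
      -- As for the star, only the label of the principal formula is matched up to equality; `x` and
      -- `y` are those of the ternary atom.
      obtain ⟨u, hu, he⟩ := h.exists_eqJudgment (x := w) (y := z) hz.symm
      obtain ⟨v, hv, hsv, htv⟩ := h.directed s hs t ht
      obtain ⟨r, hr', hvr, hur⟩ := h.directed v hv u hu
      obtain ⟨q, hq, h₁ | h₂⟩ := h.wandL x y w z A B hAS r hr' (hvr.1 (htv.1 hr))
        (he.mono hur.1) (hvr.2.1 (hsv.2.1 hm))
      · exact ((ihA x).2 q hq h₁ hfx).elim
      · exact (ihB y).1 q hq h₂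
    · obtain ⟨t, ht, x, y, hr, hx, hy⟩ := h.right w _ hAS s hs hm
      exact (ihB y).2 t ht hy (hf (world I x) (world I y)
        ⟨x, w, y, ⟨t, ht, hr⟩, rfl, rfl, rfl⟩ ((ihA x).1 t ht hx))

end Saturated

end Calculus

end LSG

theorem mainTheorem1 {Var : Type*} [DecidableEq Var]
    (Fr : Set LSG.FrameAxiom) (hFr : Fr.Finite) (F : LSG.Formula Var)
    (w : LSG.Label) (hw : w ≠ LSG.Term.eps)
    (hF : ¬ LSG.CutFreeDerivable Fr ⟨∅, ∅, {(w, F)}⟩) :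
    ∃ M : LSG.KripkeModel.{_, 0} Var,
      (∀ ax ∈ Fr, M.toKripkeFrame.Satisfies ax) ∧ ∃ h : M.World, ¬ M.Forces h F := by
  -- Finiteness enters only through the countability of the tasks.
  have : Countable Fr := hFr.countable
  obtain ⟨I, hI, hmem⟩ := LSG.exists_saturated_family F.subformulas _ hF
  exact ⟨LSG.canonicalModel I, hI.satisfies, LSG.world I w,
    (hI.truth F subset_rfl w).2 _ hmem (Finset.mem_singleton_self _)⟩
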